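/- Let $\mathbb N$ be the set of non-negative integers. A one-tape NTM is a tuple $M=(Q,\Sigma,\Gamma,\sqcup,\delta,q_0,q_a,q_r)$ with a finite set $Q$ of states, a finite tape alphabet $\Gamma$, a nonempty input alphabet $\Sigma\subseteq\Gamma$, a blank symbol $\sqcup\in\Gamma\setminus\Sigma$, pairwise distinct starting, accepting and rejecting states $q_0,q_a,q_r\in Q$, and a transition function $\delta\colon (Q\setminus\{q_a,q_r\})\times\Gamma\to\mathcal P(Q\times\Gamma\times\{-1,1\})\setminus\{\emptyset\}$. The tape is infinite in both directions with cells indexed by $\mathbb Z$. An input $w\in\Sigma^*$ is written in the cells $0,\dots,|w|-1$, all other cells are blank, and the head starts in cell $0$ in state $q_0$. A computation $\zeta$ of $M$ on $w$ runs until a halting state ($q_a$ or $q_r$) is reached, or forever; its length $|\zeta|\in\mathbb N\cup\{\infty\}$ is its number of steps. For $T\colon\mathbb N\to\mathbb N$, $M$ runs in time $T(n)$ if, for every $n$, $|\zeta|\le T(n)$ for every computation $\zeta$ on every input of length $n$. Boundary $i$ of the tape lies between the cells $i-1$ and $i$. For $t\in\mathbb N$, $t\le|\zeta|$, let $\mathcal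 C_i^t(M,\zeta,w)$ be the sequence of the states of $M$ immediately after those of the first $t$ steps of $\zeta$ that cross boundary $i$, in order (the crossing sequence). For $n\geq 1$ let $\mathrm{CS}_n(M)$ be the set of all $\mathcal C_i^t(M,\zeta,w)$ with $w$ an input of length $n$, $1\le i\le n$, $\zeta$ a computation on $w$ and $t\in\mathbb N$, $t\le|\zeta|$. Let $w\in\Sigma^n$ with $n\ge1$ and let $\mathcal C=(q_1,\dots,q_l)$ be a finite sequence of states. A computation of $M$ on the part $w$ with ending crossing sequence $\mathcal C$ is a finite sequence of configurations $(\mathcal C_1,\tilde w,i,\tilde q,\mathcal C_2)$, where $\mathcal C_1,\mathcal C_2$ are finite sequences of states, $\tilde w\in\Gamma^n$, $0\le i\le n-1$ and $\tilde q\in Q$, as follows. It starts with $((q_2,\dots,q_l),w,0,q_1,(q_1,\dots,q_l))$ (so there is none if $l=0$). Configuration $(\mathcal C_{1A},w_A,i,q_A,\mathcal C_{2A})$ may be followed by $(\mathcal C_{1B},w_B,j,q_B,\mathcal C_{2B})$ in exactly these cases: (1) $\delta$ allows $(w_A,i,q_A)$ to change into $(w_B,j,q_B)$ in one ordinary step,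 $\mathcal C_{1A}=\mathcal C_{1B}$ and $\mathcal C_{2A}=\mathcal C_{2B}$; (2) $i=j=0$, $\mathcal C_{1A}=(p,q_B,\mathcal C_{1B})$ for some $p\in Q$, $\mathcal C_{2A}=\mathcal C_{2B}$, and $w_B$ arises from $w_A$ by replacing the symbol $a$ in cell $0$ by some $b$ with $(p,b,-1)\in\delta(q_A,a)$; (3) $i=j=n-1$, $\mathcal C_{2A}=(p,q_B,\mathcal C_{2B})$ for some $p\in Q$, $\mathcal C_{1A}=\mathcal C_{1B}$, and $w_B$ arises from $w_A$ by replacing the symbol $a$ in cell $n-1$ by some $b$ with $(p,b,1)\in\delta(q_A,a)$. It ends by moving to a special ending configuration, either from $((q_l),\tilde w,0,\tilde q,())$ where $(q_l,b,-1)\in\delta(\tilde q,a)$ for some $b\in\Gamma$, with $a$ the symbol of $\tilde w$ in cell $0$, or from $((),\tilde w,n-1,\tilde q,(q_l))$ where $(q_l,b,1)\in\delta(\tilde q,a)$ for some $b\in\Gamma$, with $a$ the symbol of $\tilde w$ in cell $n-1$. Its length is $l$ plus the sum, over the inner boundaries $i=1,\dots,n-1$, of the number of times the head moves across boundary $i$,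 i.e. between cells $i-1$ and $i$. Let $t_M(w,\mathcal C)$ be the supremum (in $\mathbb N\cup\{\infty\}$) of the lengths of these computations, and $t_M(w,\mathcal C)=-1$ if there is none. **Theorem 1 (The compactness theorem).** Let $M$ be a one-tape NTM with $q$ states and let $C,D\in\mathbb N$. Put $\ell=D+8q^C$, $r=D+12q^C$ and $\mathrm{CS}=\bigcup_{n=1}^{\ell}\mathrm{CS}_n(M)$. Then $M$ runs in time $Cn+D$ if and only if both of the following hold: (a) for each input $w$ of length at most $\ell$ and each computation $\zeta$ of $M$ on $w$, $|\zeta|\le C|w|+D$; and (b) for each $\mathcal C\in\mathrm{CS}$ and each part $w\in\Sigma^*$ with $1\le|w|\le r$ for which $t_M(w,\mathcal C)\ge0$, it holds that $t_M(w,\mathcal C)\le C|w|$. -/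

import Mathlib

/-- A one-tape nondeterministic Turing machine `(Q, Σ, Γ, blank, δ, q₀, qa, qr)` with states `Q`
and tape alphabet `Γ`. The moves `-1`, `1` are the two elements of `ℤˣ`. The transition function
has a nonempty set of choices exactly on the non-halting states (on the two halting states, where
it is usually left undefined, it is empty). -/
structure OneTapeNTM (Q Γ : Type*) where
  inputAlphabet : Set Γ
  inputAlphabet_nonempty : inputAlphabet.Nonempty
  blank : Γ
  blank_notMem : blank ∉ inputAlphabet
  q₀ : Q
  qa : Q
  qr : Q
  q₀_ne_qa : q₀ ≠ qa
  q₀_ne_qr : q₀ ≠ qr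
  qa_ne_qr : qa ≠ qr
  δ : Q → Γ → Set (Q × Γ × ℤˣ)
  δ_nonempty_iff : ∀ q a, (δ q a).Nonempty ↔ q ≠ qa ∧ q ≠ qr

namespace OneTapeNTM

variable {Q Γ : Type*}

/-- `w` is an input, i.e. a (possibly empty) word over the input alphabet. -/
def IsInput (M : OneTapeNTM Q Γ) (w : List Γ) : Prop :=
  ∀ a ∈ w, a ∈ M.inputAlphabet

/-- A configuration on the two-way infinite tape. -/
structure Cfg (Q Γ : Type*) where
  state : Q
  head : ℤ
  tape : ℤ → Γ

/-- The starting configuration on `w`: the word is written in the cells `0, …, |w| - 1`,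
all other cells are blank, and the head is in cell `0`. -/
def startCfg (M : OneTapeNTM Q Γ) (w : List Γ) : Cfg Q Γ where
  state := M.q₀
  head := 0
  tape := fun z => if 0 ≤ z then w.getD z.toNat M.blank else M.blank

/-- `B` is a successor of `A`. -/
def Step (M : OneTapeNTM Q Γ) (A B : Cfg Q Γ) : Prop :=
  ∃ (b : Γ) (d : ℤˣ), (B.state, b, d) ∈ M.δ A.state (A.tape A.head) ∧
    B.head = A.head + (d : ℤ) ∧ B.tape = Function.update A.tape A.head b

/-- A computation of `M` on `w`, of finite or infinite length `len` (the number of steps).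
A finite computation ends in a halting state. Only `cfg s` with `s ≤ len` is meaningful. -/
structure Computation (M : OneTapeNTM Q Γ) (w : List Γ) where
  len : ℕ∞
  cfg : ℕ → Cfg Q Γ
  cfg_zero : cfg 0 = M.startCfg w
  step : ∀ s : ℕ, (s : ℕ∞) < len → M.Step (cfg s) (cfg (s + 1))
  halts : ∀ s : ℕ, (s : ℕ∞) = len → (cfg s).state = M.qa ∨ (cfg s).state = M.qr

/-- `M` runs in time `T`. -/
def RunsInTime (M : OneTapeNTM Q Γ) (T : ℕ → ℕ) : Prop :=
  ∀ n : ℕ, ∀ w : List Γ, M.IsInput w → w.length = n →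
    ∀ ζ : M.Computation w, ζ.len ≤ (T n : ℕ∞)

/-- A move of the head from cell `h` to cell `h'` crosses the boundary `i`, the one between the
cells `i - 1` and `i`. -/
def Crosses (i h h' : ℤ) : Prop :=
  (h = i - 1 ∧ h' = i) ∨ (h = i ∧ h' = i - 1)

instance (i h h' : ℤ) : Decidable (Crosses i h h') := by
  unfold Crosses; infer_instance

/-- The crossing sequence produced by `ζ` on boundary `i` in its first `t` steps
(meaningful for `t ≤ len`): the states just after the steps that cross the boundary. -/
def Computation.crossingSeq {M : OneTapeNTM Q Γ} {w : List Γ} (ζ : M.Computation w)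
    (i : ℤ) (t : ℕ) : List Q :=
  ((List.range t).filter fun s => Crosses i (ζ.cfg s).head (ζ.cfg (s + 1)).head).map
    fun s => (ζ.cfg (s + 1)).state

/-- The set of all (finite) beginnings of crossing sequences that `M` produces on inputs of
length `n` on the boundaries `1, …, n`. -/
def crossingSet (M : OneTapeNTM Q Γ) (n : ℕ) : Set (List Q) :=
  {crs | ∃ w : List Γ, M.IsInput w ∧ w.length = n ∧
    ∃ i : ℕ, 1 ≤ i ∧ i ≤ n ∧ ∃ ζ : M.Computation w, ∃ t : ℕ, (t : ℕ∞) ≤ ζ.len ∧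
      crs = ζ.crossingSeq i t}

/-- A configuration `(left, word, head, state, right)` on a part of length `n`; `left` and `right`
are what remains to be matched of the left and the right crossing sequence. -/
structure PartCfg (Q Γ : Type*) (n : ℕ) where
  left : List Q
  word : Fin n → Γ
  head : Fin n
  state : Q
  right : List Q

/-- `B` is a successor of `A` on a part: an ordinary step inside the part, or a step out
over the left (right) end that is immediately followed by the return into the same cell, the two
crossings being matched with the left (right) crossing sequence. -/
def PartStep (M : OneTapeNTM Q Γ) {n : ℕ} (A B : PartCfg Q Γ n) : Prop :=
  (∃ (b : Γ) (d : ℤˣ), (B.state, b, d) ∈ M.δ A.state (A.word A.head) ∧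
    (B.head : ℤ) = (A.head : ℤ) + (d : ℤ) ∧ B.word = Function.update A.word A.head b ∧
    A.left = B.left ∧ A.right = B.right) ∨
  (∃ (p : Q) (b : Γ), (A.head : ℕ) = 0 ∧ B.head = A.head ∧
    A.left = p :: B.state :: B.left ∧ B.word = Function.update A.word A.head b ∧
    (p, b, -1) ∈ M.δ A.state (A.word A.head) ∧ A.right = B.right) ∨
  (∃ (p : Q) (b : Γ), (A.head : ℕ) + 1 = n ∧ B.head = A.head ∧
    A.right = p :: B.state :: B.right ∧ B.word = Function.update A.word A.head b ∧
    (p, b, 1) ∈ M.δ A.state (A.word A.head) ∧ A.left = B.left)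

/-- The special ending configuration can be reached from `A`: the head can leave the part
for good, matching the last state of `crs`. -/
def PartEnds (M : OneTapeNTM Q Γ) (crs : List Q) {n : ℕ} (A : PartCfg Q Γ n) : Prop :=
  ∃ (p : Q) (b : Γ), crs.getLast? = some p ∧
    ((A.left = [p] ∧ (A.head : ℕ) = 0 ∧ A.right = [] ∧
        (p, b, -1) ∈ M.δ A.state (A.word A.head)) ∨
      (A.left = [] ∧ (A.head : ℕ) + 1 = n ∧ A.right = [p] ∧
        (p, b, 1) ∈ M.δ A.state (A.word A.head)))

/-- A computation of `M` on the part `w` with ending crossing sequence `crs`: the configurations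
`cfg 0, …, cfg last`, followed by the special ending configuration. Only `cfg s` with `s ≤ last`
is meaningful. There is none if `crs` or `w` is empty. -/
structure PartComputation (M : OneTapeNTM Q Γ) (w : List Γ) (crs : List Q) where
  last : ℕ
  cfg : ℕ → PartCfg Q Γ w.length
  start_head : ((cfg 0).head : ℕ) = 0
  start_word : (cfg 0).word = w.get
  start_left : crs = (cfg 0).state :: (cfg 0).left
  start_right : (cfg 0).right = crs
  step : ∀ s < last, M.PartStep (cfg s) (cfg (s + 1))
  ends : M.PartEnds crs (cfg last)

/-- The crossing sequence generated on the inner boundary `i` of the part. -/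
def PartComputation.crossingSeq {M : OneTapeNTM Q Γ} {w : List Γ} {crs : List Q}
    (ζ : M.PartComputation w crs) (i : ℤ) : List Q :=
  ((List.range ζ.last).filter
    fun s => Crosses i ((ζ.cfg s).head : ℕ) ((ζ.cfg (s + 1)).head : ℕ)).map
      fun s => (ζ.cfg (s + 1)).state

/-- The length `∑_{i=1}^{|w|-1} |crs_i| + |crs|` of a computation on a part. -/
def PartComputation.length {M : OneTapeNTM Q Γ} {w : List Γ} {crs : List Q}
    (ζ : M.PartComputation w crs) : ℕ :=
  (∑ i ∈ Finset.Ico 1 w.length, (ζ.crossingSeq i).length) + crs.length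

/-- `t_M(w, crs)`, the maximal length of a computation of `M` on the part `w` with ending crossing
sequence `crs`. It is `⊥` (in the role of `-1`) if there is no such computation, and `⊤` if the
lengths are unbounded. -/
noncomputable def partTime (M : OneTapeNTM Q Γ) (w : List Γ) (crs : List Q) : WithBot ℕ∞ :=
  ⨆ ζ : M.PartComputation w crs, ((ζ.length : ℕ∞) : WithBot ℕ∞)

end OneTapeNTM

/-!
A run of a one-tape machine can be reconstructed from its crossing sequences: a family `c` of
crossing sequences, one for each boundary, comes from a run if and only if on each single cell the
sequences of its two boundaries fit together (`CellRun`), since the cell under the head always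
determines which neighbour the head visits next and what that neighbour expects. This holds on the
whole tape (`matches_crossings`, `Matches.exists_run`) and on parts
(`PartComputation.exists_partMatches`, `PartMatches.exists_partComputation`); on a part, the head
leaves in the end because the number of crossings of its two ends ahead of it is odd. The length of
a run is the total length of the family. Cutting out the part between two boundaries with equal
crossing sequences, and inserting a part with matching sequences on its ends, is then nothing but
removing or inserting members of the family (`Realizes.cut`, `Realizes.insert`).

If `M` runs in time `C n + D`, then no computation on a part `x` with ending crossing sequence from
`CS` is longer than `C |x|`: inserting many copies of `x` at a boundary with that crossing sequence
would break the time bound (`RunsInTime.partComputation_length_le`).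

Conversely, take a shortest input `w` that breaks the bound, and the first `C |w| + D + 1` steps of
a computation on it. Let `S` be the sum of `C + 1 - |u|` over all sequences `u` of at most `C`
states. On boundaries with distinct crossing sequences, the lengths of these add up to at least
`C + 1` per boundary, minus `S` in total (`mul_card_le_of_injOn`), and `4 S ≤ 9 q ^ C` as there are
at least three states. As the crossing sequences on `w` have total length at most `C |w| + D + 1`,
two of them, at a distance of at most `r`, are equal (`mul_add_min_le_of_forall_ne`). Moreover all of
them belong to `CS`: with one boundary `i` kept, the input can be shortened by cuts on either side of
`i` until its length is at most `ℓ` (`Realizes.mem_iUnion_crossingSet`). So the part between the two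
boundaries takes at most `C` steps per cell, and cutting it out leaves a shorter input that breaks
the bound.
-/

namespace OneTapeNTM

variable {Q Γ : Type*} {M : OneTapeNTM Q Γ}

/-! ### The history of a single cell -/

/-- Where the head is, as seen from one cell: strictly to the left, in the cell in a given state,
or strictly to the right. -/
inductive HeadPos (Q : Type*) where
  | left : HeadPos Q
  | inside : Q → HeadPos Q
  | right : HeadPos Q

/-- The position of the head, being in cell `h` in state `p`, as seen from the cell `k`. -/
def headPos (h : ℤ) (p : Q) (k : ℤ) : HeadPos Q :=
  if h < k then .left else if k < h then .right else .inside p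

/-- `CellRun M a x u v`: the history of a single cell that contains `a` and sees the head at `x`
can consist of exactly the crossings `u` of its left boundary and `v` of its right boundary. The
head may rest anywhere in the end, in particular inside the cell. -/
inductive CellRun (M : OneTapeNTM Q Γ) : Γ → HeadPos Q → List Q → List Q → Prop
  | idle (a : Γ) (x : HeadPos Q) : CellRun M a x [] []
  | enterLeft {a : Γ} {p : Q} {u v : List Q} :
      CellRun M a (.inside p) u v → CellRun M a .left (p :: u) v
  | enterRight {a : Γ} {p : Q} {u v : List Q} :
      CellRun M a (.inside p) u v → CellRun M a .right u (p :: v)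
  | exitLeft {a b : Γ} {p p' : Q} {u v : List Q} :
      (p', b, -1) ∈ M.δ p a → CellRun M b .left u v → CellRun M a (.inside p) (p' :: u) v
  | exitRight {a b : Γ} {p p' : Q} {u v : List Q} :
      (p', b, 1) ∈ M.δ p a → CellRun M b .right u v → CellRun M a (.inside p) u (p' :: v)

lemma CellRun.right_eq_nil {a : Γ} {v : List Q} (hr : CellRun M a .left [] v) : v = [] := by
  cases hr; rfl

lemma CellRun.left_eq_nil {a : Γ} {u : List Q} (hr : CellRun M a .right u []) : u = [] := by
  cases hr; rfl

/-- The contribution to the crossing sequence of boundary `i` of a single move from `h` to `h'`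
into the state `p`. -/
def crossing (i h h' : ℤ) (p : Q) : List Q := if Crosses i h h' then [p] else []

lemma crossing_right (k h : ℤ) (p : Q) :
    crossing k h (h + ((1 : ℤˣ) : ℤ)) p = if k = h + 1 then [p] else [] := by
  have : Crosses k h (h + 1) ↔ k = h + 1 := by unfold Crosses; omega
  simp [crossing, this]

lemma crossing_left (k h : ℤ) (p : Q) :
    crossing k h (h + ((-1 : ℤˣ) : ℤ)) p = if k = h then [p] else [] := by
  have : Crosses k h (h + -1) ↔ k = h := by unfold Crosses; omega
  simp [crossing, this]

/-- Every move crosses exactly one boundary. -/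
lemma crossing_eq (k h : ℤ) (d : ℤˣ) (p : Q) :
    crossing k h (h + d) p = if k = max h (h + d) then [p] else [] := by
  rcases Int.units_eq_one_or d with rfl | rfl
  · rw [crossing_right, max_eq_right (by simp), Units.val_one]
  · rw [crossing_left, max_eq_left (by simp)]

/-- A step of the machine prolongs the history of every cell at its front. -/
lemma CellRun.cons_step {k h h' : ℤ} {d : ℤˣ} {p p' : Q} {a a' : Γ} {u v : List Q}
    (hh : h' = h + d) (hin : k = h → (p', a', d) ∈ M.δ p a) (hout : k ≠ h → a' = a)
    (hr : CellRun M a' (headPos h' p' k) u v) :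
    CellRun M a (headPos h p k) (crossing k h h' p' ++ u) (crossing (k + 1) h h' p' ++ v) := by
  subst hh
  rcases Int.units_eq_one_or d with rfl | rfl
  · rw [crossing_right, crossing_right]
    rw [Units.val_one, headPos] at hr
    rcases lt_trichotomy k h with hk | rfl | hk
    · obtain rfl := hout hk.ne
      simpa (disch := omega) only [headPos, if_pos, if_neg, List.nil_append] using hr
    · simp (disch := omega) only [headPos, if_pos, if_neg, List.nil_append] at hr ⊢
      exact .exitRight (hin rfl) hr
    · obtain rfl := hout hk.ne'
      rcases (Int.add_one_le_iff.2 hk).eq_or_lt with rfl | hk1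
      · simp (disch := omega) only [headPos, if_pos, if_neg, List.nil_append] at hr ⊢
        exact .enterLeft hr
      · simpa (disch := omega) only [headPos, if_pos, if_neg, List.nil_append] using hr
  · rw [crossing_left, crossing_left]
    rw [Units.val_neg, Units.val_one, headPos] at hr
    rcases lt_trichotomy k h with hk | rfl | hk
    · obtain rfl := hout hk.ne
      rcases (Int.add_one_le_iff.2 hk).eq_or_lt with rfl | hk1
      · simp (disch := omega) only [headPos, if_pos, if_neg, List.nil_append] at hr ⊢
        exact .enterRight hr
      · simpa (disch := omega) only [headPos, if_pos, if_neg, List.nil_append] using hr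
    · simp (disch := omega) only [headPos, if_pos, if_neg, List.nil_append] at hr ⊢
      exact .exitLeft (hin rfl) hr
    · obtain rfl := hout hk.ne'
      simpa (disch := omega) only [headPos, if_pos, if_neg, List.nil_append] using hr

/-- Conversely, on a cell not under the head, a move can be removed from the front of the
history. -/
lemma CellRun.of_cons_step {k h h' : ℤ} {d : ℤˣ} {p p' : Q} {a : Γ} {u v : List Q}
    (hh : h' = h + d) (hk : k ≠ h)
    (hr : CellRun M a (headPos h p k) (crossing k h h' p' ++ u) (crossing (k + 1) h h' p' ++ v)) :
    CellRun M a (headPos h' p' k) u v := by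
  subst hh
  rcases Int.units_eq_one_or d with rfl | rfl
  · rw [crossing_right, crossing_right, headPos] at hr
    rw [Units.val_one, headPos]
    rcases hk.lt_or_gt with hk | hk
    · simpa (disch := omega) only [if_pos, if_neg, List.nil_append] using hr
    · rcases (Int.add_one_le_iff.2 hk).eq_or_lt with rfl | hk1
      · simp (disch := omega) only [if_pos, if_neg, List.nil_append] at hr ⊢
        cases hr
        assumption
      · simpa (disch := omega) only [if_pos, if_neg, List.nil_append] using hr
  · rw [crossing_left, crossing_left, headPos] at hr
    rw [Units.val_neg, Units.val_one, headPos]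
    rcases hk.lt_or_gt with hk | hk
    · rcases (Int.add_one_le_iff.2 hk).eq_or_lt with rfl | hk1
      · simp (disch := omega) only [if_pos, if_neg, List.nil_append] at hr ⊢
        cases hr
        assumption
      · simpa (disch := omega) only [if_pos, if_neg, List.nil_append] using hr
    · simpa (disch := omega) only [if_pos, if_neg, List.nil_append] using hr

/-- The history of the cell under the head is empty or begins with a step. -/
lemma CellRun.exists_step {h : ℤ} {p : Q} {a : Γ} {u v : List Q}
    (hr : CellRun M a (.inside p) u v) :
    (u = [] ∧ v = []) ∨ ∃ (p' : Q) (b : Γ) (d : ℤˣ) (u' v' : List Q), (p', b, d) ∈ M.δ p a ∧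
      u = crossing h h (h + d) p' ++ u' ∧ v = crossing (h + 1) h (h + d) p' ++ v' ∧
      CellRun M b (headPos (h + d) p' h) u' v' := by
  cases hr with
  | idle => exact .inl ⟨rfl, rfl⟩
  | @exitLeft _ b _ p' u' _ hδ hr =>
    refine .inr ⟨p', b, -1, u', v, hδ, by rw [crossing_left]; simp,
      by rw [crossing_left]; simp, ?_⟩
    simpa [headPos] using hr
  | @exitRight _ b _ p' _ v' hδ hr =>
    refine .inr ⟨p', b, 1, u, v', hδ, by rw [crossing_right]; simp,
      by rw [crossing_right]; simp, ?_⟩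
    simpa [headPos] using hr

@[simp]
lemma crossing_self (k h : ℤ) (p : Q) : crossing k h h p = [] := by
  rw [crossing, if_neg]
  unfold Crosses
  omega

/-- The crossing sequence on boundary `i` of the first `t` moves of a sequence of head positions
and states. -/
def crossings (hd : ℕ → ℤ) (st : ℕ → Q) (i : ℤ) (t : ℕ) : List Q :=
  ((List.range t).filter fun s => Crosses i (hd s) (hd (s + 1))).map fun s => st (s + 1)

@[simp]
lemma crossings_zero (hd : ℕ → ℤ) (st : ℕ → Q) (i : ℤ) : crossings hd st i 0 = [] := rfl

lemma crossings_succ (hd : ℕ → ℤ) (st : ℕ → Q) (i : ℤ) (t : ℕ) :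
    crossings hd st i (t + 1) = crossing i (hd 0) (hd 1) (st 1) ++
      crossings (fun s => hd (s + 1)) (fun s => st (s + 1)) i t := by
  unfold crossings crossing
  rw [List.range_succ_eq_map, List.filter_cons]
  by_cases h : Crosses i (hd 0) (hd 1) <;>
    simp [h, List.filter_map, Function.comp_def]

lemma crossings_congr {hd hd' : ℕ → ℤ} {st st' : ℕ → Q} {t : ℕ}
    (h : ∀ s ≤ t, hd s = hd' s) (h' : ∀ s ≤ t, st s = st' s) (i : ℤ) :
    crossings hd st i t = crossings hd' st' i t := by
  unfold crossings
  have e : (List.range t).filter (fun s => Crosses i (hd s) (hd (s + 1))) =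
      (List.range t).filter (fun s => Crosses i (hd' s) (hd' (s + 1))) := by
    refine List.filter_congr fun s hs => ?_
    have := List.mem_range.1 hs
    rw [h s (by omega), h (s + 1) (by omega)]
  rw [e]
  refine List.map_congr_left fun s hs => ?_
  have := List.mem_range.1 (List.mem_filter.1 hs).1
  exact h' _ (by omega)

/-! ### Computations as families of crossing sequences -/

/-- Every cell of the two-way infinite tape has a history from the configuration `A` on, with the
crossing sequence `c k` on boundary `k`. -/
def Matches (M : OneTapeNTM Q Γ) (A : Cfg Q Γ) (c : ℤ → List Q) : Prop :=
  ∀ k, CellRun M (A.tape k) (headPos A.head A.state k) (c k) (c (k + 1))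

/-- The family `c` of crossing sequences has finite total length `t`. -/
def HasTotal (c : ℤ → List Q) (t : ℕ) : Prop :=
  ∃ a b : ℤ, (∀ k, k ≤ a ∨ b < k → c k = []) ∧ ∑ k ∈ Finset.Ioc a b, (c k).length = t

/-- The window in `HasTotal` may be taken as large as desired. -/
lemma HasTotal.exists_window {c : ℤ → List Q} {t : ℕ} (h : HasTotal c t) (a₀ b₀ : ℤ) :
    ∃ a ≤ a₀, ∃ b ≥ b₀, (∀ k, k ≤ a ∨ b < k → c k = []) ∧
      ∑ k ∈ Finset.Ioc a b, (c k).length = t := by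
  obtain ⟨a, b, h0, rfl⟩ := h
  refine ⟨min a a₀, min_le_right _ _, max b b₀, le_max_right _ _, fun k hk => h0 k (by omega), ?_⟩
  refine (Finset.sum_subset (Finset.Ioc_subset_Ioc (min_le_left _ _) (le_max_left _ _)) ?_).symm
  intro k _ hk
  rw [h0 k (by simp at hk; omega), List.length_nil]

lemma HasTotal.sum_le {c : ℤ → List Q} {t : ℕ} (h : HasTotal c t) (a b : ℤ) :
    ∑ k ∈ Finset.Ioc a b, (c k).length ≤ t := by
  obtain ⟨a', ha, b', hb, -, rfl⟩ := h.exists_window a b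
  exact Finset.sum_le_sum_of_subset (Finset.Ioc_subset_Ioc ha hb)

lemma sum_length_crossing {s : Finset ℤ} {c : ℤ → List Q} {h : ℤ} {d : ℤˣ} {p : Q}
    (hs : max h (h + d) ∈ s) :
    ∑ k ∈ s, (crossing k h (h + d) p ++ c k).length = ∑ k ∈ s, (c k).length + 1 := by
  simp only [List.length_append, Finset.sum_add_distrib, crossing_eq, apply_ite List.length,
    List.length_cons, List.length_nil, Finset.sum_ite_eq', hs, if_true]
  omega

/-- The crossing sequences of a run match on every cell, and their total length is the number of
steps, as every step crosses exactly one boundary. -/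
lemma matches_crossings {cfg : ℕ → Cfg Q Γ} {t : ℕ}
    (hs : ∀ s < t, M.Step (cfg s) (cfg (s + 1))) :
    Matches M (cfg 0) (fun k => crossings (fun s => (cfg s).head) (fun s => (cfg s).state) k t) ∧
    HasTotal (fun k => crossings (fun s => (cfg s).head) (fun s => (cfg s).state) k t) t := by
  induction t generalizing cfg with
  | zero => exact ⟨fun k => .idle _ _, 0, 0, fun _ _ => rfl, by simp⟩
  | succ t ih =>
    obtain ⟨hm, ht⟩ := ih (cfg := fun s => cfg (s + 1)) fun s h => hs (s + 1) (by omega)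
    obtain ⟨b, d, hδ, hh, htape⟩ := hs 0 (by omega)
    simp only [zero_add] at hδ hh htape
    simp only [crossings_succ]
    refine ⟨fun k => ?_, ?_⟩
    · refine CellRun.cons_step hh (fun hk => ?_) (fun hk => ?_) (hm k)
      · simpa [htape, hk] using hδ
      · simp [htape, hk]
    · obtain ⟨a₁, ha, b₁, hb, h0, hsum⟩ :=
        ht.exists_window ((cfg 0).head - 2) ((cfg 0).head + 2)
      refine ⟨a₁, b₁, fun k hk => ?_, ?_⟩
      · beta_reduce
        rw [h0 k hk, hh, crossing_eq, if_neg]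
        · rfl
        · rcases Int.units_eq_one_or d with rfl | rfl <;> simp <;> omega
      · rw [hh, sum_length_crossing, hsum]
        rcases Int.units_eq_one_or d with rfl | rfl <;> simp <;> omega

lemma eq_nil_of_left {c : ℤ → List Q} {x y k : ℤ}
    (h : ∀ j, x ≤ j → j < y → ∃ a, CellRun M a .left (c j) (c (j + 1))) (hx : c x = [])
    (hxk : x ≤ k) (hky : k ≤ y) : c k = [] := by
  induction k, hxk using Int.leInduction with
  | base => exact hx
  | succ k hk ih =>
    obtain ⟨a, ha⟩ := h k hk (by omega)
    rw [ih (by omega)] at ha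
    exact ha.right_eq_nil

lemma eq_nil_of_right {c : ℤ → List Q} {x y k : ℤ}
    (h : ∀ j, y ≤ j → j < x → ∃ a, CellRun M a .right (c j) (c (j + 1))) (hx : c x = [])
    (hkx : k ≤ x) (hyk : y ≤ k) : c k = [] := by
  induction k, hkx using Int.leInductionDown with
  | base => exact hx
  | pred k hk ih =>
    obtain ⟨a, ha⟩ := h (k - 1) hyk (by omega)
    rw [sub_add_cancel, ih (by omega)] at ha
    exact ha.left_eq_nil

/-- If the cell under the head has no crossings left, no cell has. -/
lemma Matches.eq_nil {A : Cfg Q Γ} {c : ℤ → List Q} (hm : Matches M A c)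
    (h0 : c A.head = []) (h1 : c (A.head + 1) = []) (k : ℤ) : c k = [] := by
  rcases le_or_gt k A.head with hk | hk
  · refine eq_nil_of_right (M := M) (fun j _ hj => ⟨A.tape j, ?_⟩) h0 hk le_rfl
    simpa (disch := omega) only [headPos, if_pos, if_neg] using hm j
  · refine eq_nil_of_left (M := M) (fun j hj _ => ⟨A.tape j, ?_⟩) h1 (by omega) le_rfl
    simpa (disch := omega) only [headPos, if_pos, if_neg] using hm j

/-- A move taken off the front of a family of crossing sequences, given what remains on the two
boundaries of the cell under the head. -/
lemma eq_crossing_append {c : ℤ → List Q} {h : ℤ} {d : ℤˣ} {p : Q} {u v : List Q}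
    (hu : c h = crossing h h (h + d) p ++ u)
    (hv : c (h + 1) = crossing (h + 1) h (h + d) p ++ v) (k : ℤ) :
    c k = crossing k h (h + d) p ++ (if k = h then u else if k = h + 1 then v else c k) := by
  split_ifs with h1 h2
  · rw [h1, hu]
  · rw [h2, hv]
  · rw [crossing_eq, if_neg, List.nil_append]
    rcases Int.units_eq_one_or d with rfl | rfl <;> simp <;> omega

/-- Crossing sequences that match on every single cell come from a run. -/
lemma Matches.exists_run {t : ℕ} {A : Cfg Q Γ} {c : ℤ → List Q} (hm : Matches M A c)
    (ht : HasTotal c t) :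
    ∃ cfg : ℕ → Cfg Q Γ, cfg 0 = A ∧ (∀ s < t, M.Step (cfg s) (cfg (s + 1))) ∧
      ∀ k, crossings (fun s => (cfg s).head) (fun s => (cfg s).state) k t = c k := by
  induction t generalizing A c with
  | zero =>
    refine ⟨fun _ => A, rfl, by simp, fun k => ?_⟩
    obtain ⟨a, ha, b, hb, -, h⟩ := ht.exists_window (k - 1) k
    have := Finset.sum_eq_zero_iff.1 h k (by simp; omega)
    rw [List.length_eq_zero_iff.1 this, crossings_zero]
  | succ t ih =>
    have hA := hm A.head
    rw [headPos, if_neg (lt_irrefl _), if_neg (lt_irrefl _)] at hA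
    rcases hA.exists_step (h := A.head) with ⟨h0, h1⟩ | ⟨p', b, d, u, v, hδ, hu, hv, hr⟩
    · obtain ⟨a, b, -, h⟩ := ht
      simp [hm.eq_nil h0 h1] at h
    · set c' : ℤ → List Q := fun k => if k = A.head then u else if k = A.head + 1 then v else c k
        with hc'
      have hc : ∀ k, c k = crossing k A.head (A.head + d) p' ++ c' k := eq_crossing_append hu hv
      let B : Cfg Q Γ := ⟨p', A.head + d, Function.update A.tape A.head b⟩
      have hmB : Matches M B c' := by
        intro k
        by_cases hk : k = A.head
        · subst hk
          simpa [B, hc'] using hr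
        · have := hm k
          rw [hc k, hc (k + 1)] at this
          simpa [B, hk] using this.of_cons_step rfl hk
      have htB : HasTotal c' t := by
        obtain ⟨a₁, b₁, h0, hsum⟩ := ht
        refine ⟨a₁, b₁, fun k hk => ?_, ?_⟩
        · have := h0 k hk
          rw [hc k] at this
          exact (List.append_eq_nil_iff.1 this).2
        · simp only [hc] at hsum
          rw [sum_length_crossing] at hsum
          · omega
          · by_contra hn
            have := h0 (max A.head (A.head + d)) (by simp at hn ⊢; omega)
            rw [hc, crossing_eq, if_pos rfl] at this
            simp at this
      obtain ⟨cfg, h0, hstep, hcr⟩ := ih hmB htB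
      refine ⟨fun s => Nat.casesOn s A cfg, rfl, ?_, fun k => ?_⟩
      · rintro (_ | s) hs
        · exact ⟨b, d, by simpa [h0, B] using hδ, by simp [h0, B], by simp [h0, B]⟩
        · exact hstep s (by omega)
      · rw [crossings_succ, hc k, ← hcr k]
        simp [h0, B]

/-- Every finite run can be continued to a computation. -/
lemma exists_computation {w : List Γ} {cfg : ℕ → Cfg Q Γ} {t : ℕ} (h0 : cfg 0 = M.startCfg w)
    (hs : ∀ s < t, M.Step (cfg s) (cfg (s + 1))) :
    ∃ ζ : M.Computation w, (t : ℕ∞) ≤ ζ.len ∧ ∀ s ≤ t, ζ.cfg s = cfg s := by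
  classical
  have hnext : ∀ A : Cfg Q Γ, ∃ B, ¬ (A.state = M.qa ∨ A.state = M.qr) → M.Step A B := by
    intro A
    by_cases hA : A.state = M.qa ∨ A.state = M.qr
    · exact ⟨A, fun h => (h hA).elim⟩
    · obtain ⟨⟨p, b, d⟩, h⟩ := (M.δ_nonempty_iff A.state (A.tape A.head)).2 (not_or.1 hA)
      exact ⟨⟨p, A.head + d, Function.update A.tape A.head b⟩, fun _ => ⟨b, d, h, rfl, rfl⟩⟩
  choose next hnext using hnext
  -- Follow the given run for `t` steps, then `next`; a halting state has no successor, so none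
  -- occurs before time `t`.
  let f : ℕ → Cfg Q Γ := fun s => if s ≤ t then cfg s else next^[s - t] (cfg t)
  have hf : ∀ s, ¬ ((f s).state = M.qa ∨ (f s).state = M.qr) → M.Step (f s) (f (s + 1)) := by
    intro s hn
    rcases lt_trichotomy s t with h | rfl | h
    · simpa [f, h.le, Nat.succ_le_of_lt h] using hs s h
    · have := hnext (f s) hn
      simpa [f] using this
    · have := hnext (f s) hn
      have e : s + 1 - t = (s - t) + 1 := by omega
      simpa [f, h.not_ge, (Nat.lt_succ_of_lt h).not_ge, e, Function.iterate_succ_apply'] using this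
  have hhalt : ∀ s < t, ¬ ((f s).state = M.qa ∨ (f s).state = M.qr) := by
    intro s h
    obtain ⟨b, d, hδ, -⟩ := hs s h
    have := (M.δ_nonempty_iff (cfg s).state ((cfg s).tape (cfg s).head)).1 ⟨_, hδ⟩
    simpa [f, h.le] using this
  by_cases hex : ∃ s, (f s).state = M.qa ∨ (f s).state = M.qr
  · refine ⟨⟨(Nat.find hex : ℕ), f, by simp [f, h0], fun s h => hf s ?_, fun s h => ?_⟩, ?_, ?_⟩
    · exact Nat.find_min hex (by exact_mod_cast h)
    · obtain rfl : s = Nat.find hex := by exact_mod_cast h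
      exact Nat.find_spec hex
    · simp only [Nat.cast_le, Nat.le_find_iff]
      exact hhalt
    · intro s h
      simp [f, h]
  · push Not at hex
    refine ⟨⟨⊤, f, by simp [f, h0], fun s _ => hf s ?_, fun s h => ?_⟩, le_top, ?_⟩
    · simpa using hex s
    · exact (ENat.natCast_ne_top s h).elim
    · intro s h
      simp [f, h]

/-- The family `c` of crossing sequences, of total length `t`, matches on every cell of the tape
for the input `w`. -/
structure Realizes (M : OneTapeNTM Q Γ) (w : List Γ) (c : ℤ → List Q) (t : ℕ) : Prop where
  matches_start : Matches M (M.startCfg w) c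
  hasTotal : HasTotal c t

lemma Computation.realizes {w : List Γ} (ζ : M.Computation w) {t : ℕ} (ht : (t : ℕ∞) ≤ ζ.len) :
    Realizes M w (fun k => ζ.crossingSeq k t) t := by
  have := matches_crossings (M := M) (cfg := ζ.cfg) (t := t) fun s hs =>
    ζ.step s (lt_of_lt_of_le (by exact_mod_cast hs) ht)
  rw [ζ.cfg_zero] at this
  exact ⟨this.1, this.2⟩

lemma Realizes.exists_computation {w : List Γ} {c : ℤ → List Q} {t : ℕ}
    (h : Realizes M w c t) :
    ∃ ζ : M.Computation w, (t : ℕ∞) ≤ ζ.len ∧ ∀ k, ζ.crossingSeq k t = c k := by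
  obtain ⟨cfg, h0, hs, hc⟩ := h.matches_start.exists_run h.hasTotal
  obtain ⟨ζ, hζ, he⟩ := OneTapeNTM.exists_computation h0 hs
  refine ⟨ζ, hζ, fun k => ?_⟩
  rw [← hc k]
  exact crossings_congr (hd := fun s => (ζ.cfg s).head) (st := fun s => (ζ.cfg s).state)
    (fun s h => by rw [he s h]) (fun s h => by rw [he s h]) k

/-! ### Computations on parts as families of crossing sequences -/

/-- Every cell of the part `w` has a history with the crossing sequence `c k` on boundary `k`; the
head is to the left of the part at first. -/
def PartMatches (M : OneTapeNTM Q Γ) (w : List Γ) (c : ℤ → List Q) : Prop :=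
  ∀ (k : ℕ) (hk : k < w.length), CellRun M w[k] .left (c k) (c (k + 1))

/-- The family `c` of crossing sequences of the inner boundaries of a part of length `n`, completed
by `l` and `r` on the ends. -/
def withEnds (n : ℕ) (l r : List Q) (c : ℤ → List Q) (k : ℤ) : List Q :=
  if k ≤ 0 then l else if n ≤ k then r else c k

/-- The crossing sequences of a run on a part, together with what is left to be matched on the two
ends, match on every cell. A step out over an end and back is two crossings of that end. -/
lemma cellRun_of_partSteps {n : ℕ} {cfg : ℕ → PartCfg Q Γ n} {crs : List Q} {t : ℕ}
    (hs : ∀ s < t, M.PartStep (cfg s) (cfg (s + 1))) (he : M.PartEnds crs (cfg t)) (k : Fin n) :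
    CellRun M ((cfg 0).word k) (headPos ((cfg 0).head : ℕ) (cfg 0).state (k : ℕ))
      (withEnds n (cfg 0).left (cfg 0).right
        (fun i => crossings (fun s => ((cfg s).head : ℕ)) (fun s => (cfg s).state) i t) (k : ℕ))
      (withEnds n (cfg 0).left (cfg 0).right
        (fun i => crossings (fun s => ((cfg s).head : ℕ)) (fun s => (cfg s).state) i t)
        ((k : ℕ) + 1)) := by
  have hk := k.isLt
  induction t generalizing cfg with
  | zero =>
    obtain ⟨p, b, -, ⟨h1, h2, h3, h4⟩ | ⟨h1, h2, h3, h4⟩⟩ := he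
    · simp only [withEnds, h1, h3, crossings_zero, ite_self]
      rw [if_neg (by omega : ¬ ((k : ℕ) : ℤ) + 1 ≤ 0)]
      by_cases hk0 : (k : ℕ) = 0
      · rw [if_pos (by omega), headPos, if_neg (by omega), if_neg (by omega)]
        obtain rfl : (cfg 0).head = k := Fin.ext (by omega)
        exact .exitLeft h4 (.idle _ _)
      · rw [if_neg (by omega)]
        exact .idle _ _
    · simp only [withEnds, h1, h3, crossings_zero]
      rw [if_neg (by omega : ¬ ((k : ℕ) : ℤ) + 1 ≤ 0), if_neg (by omega : ¬ (n : ℤ) ≤ (k : ℕ)),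
        ite_self]
      by_cases hk0 : (k : ℕ) + 1 = n
      · rw [if_pos (by omega), headPos, if_neg (by omega), if_neg (by omega)]
        obtain rfl : (cfg 0).head = k := Fin.ext (by omega)
        exact .exitRight h4 (.idle _ _)
      · rw [if_neg (by omega)]
        exact .idle _ _
  | succ t ih =>
    have hr := ih (cfg := fun s => cfg (s + 1)) (fun s h => hs (s + 1) (by omega)) he
    have hA := (cfg 0).head.isLt
    have hB := (cfg 1).head.isLt
    rcases hs 0 (by omega) with ⟨b, d, hδ, hh, hw, hl, hr'⟩ | ⟨p, b, h0, hh, hl, hw, hδ, hr'⟩ |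
      ⟨p, b, h0, hh, hl, hw, hδ, hr'⟩ <;> simp only [zero_add] at *
    · have key (j : ℤ) : withEnds n (cfg 0).left (cfg 0).right (fun i => crossings
            (fun s => ((cfg s).head : ℕ)) (fun s => (cfg s).state) i (t + 1)) j =
          crossing j ((cfg 0).head : ℕ) ((cfg 1).head : ℕ) (cfg 1).state ++
          withEnds n (cfg 1).left (cfg 1).right (fun i => crossings
            (fun s => ((cfg (s + 1)).head : ℕ)) (fun s => (cfg (s + 1)).state) i t) j := by
        have hd : (d : ℤ) = 1 ∨ (d : ℤ) = -1 := by
          rcases Int.units_eq_one_or d with rfl | rfl <;> simp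
        unfold withEnds
        split_ifs with h1 h2
        · rw [hh, crossing_eq, if_neg (by omega), hl, List.nil_append]
        · rw [hh, crossing_eq, if_neg (by omega), hr', List.nil_append]
        · beta_reduce
          rw [crossings_succ]
      rw [key, key]
      refine CellRun.cons_step hh (fun hk => ?_) (fun hk => ?_) hr
      · obtain rfl : k = (cfg 0).head := Fin.ext (by omega)
        simpa [hw] using hδ
      · rw [hw, Function.update_of_ne]
        rintro rfl
        exact hk rfl
    · simp only [crossings_succ, hh, crossing_self, List.nil_append] at hr ⊢
      by_cases hk0 : k = (cfg 0).head
      · subst hk0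
        rw [hw, Function.update_self] at hr
        simp (disch := omega) only [headPos, withEnds, if_pos, if_neg, hl, hr'] at hr ⊢
        exact .exitLeft hδ (.enterLeft hr)
      · have : (k : ℕ) ≠ 0 := fun h => hk0 (Fin.ext (by omega))
        rw [hw, Function.update_of_ne hk0] at hr
        simpa (disch := omega) only [headPos, withEnds, if_pos, if_neg, hr'] using hr
    · simp only [crossings_succ, hh, crossing_self, List.nil_append] at hr ⊢
      by_cases hk0 : k = (cfg 0).head
      · subst hk0
        rw [hw, Function.update_self] at hr
        have hn : (n : ℤ) ≤ ((cfg 0).head : ℕ) + 1 := by omega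
        simp (disch := omega) only [headPos, withEnds, if_neg, hl, hr', hn, if_true] at hr ⊢
        exact .exitRight hδ (.enterRight hr)
      · have : (k : ℕ) + 1 ≠ n := fun h => hk0 (Fin.ext (by omega))
        have hne : (k : ℕ) ≠ (cfg 0).head := fun h => hk0 (Fin.ext h)
        rw [hw, Function.update_of_ne hk0] at hr
        simpa (disch := omega) only [headPos, withEnds, if_pos, if_neg, hr'] using hr

lemma sum_Ioc_zero_natCast (f : ℤ → ℕ) (n : ℕ) :
    ∑ k ∈ Finset.Ioc (0 : ℤ) n, f k = ∑ i ∈ Finset.range n, f (i + 1) := by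
  induction n with
  | zero => simp
  | succ n ih =>
    rw [Finset.sum_range_succ, ← ih, Nat.cast_succ,
      ← Finset.insert_Ioc_right_eq_Ioc_add_one (by omega : (0 : ℤ) ≤ n),
      Finset.sum_insert (by simp), add_comm]

lemma PartComputation.length_eq {w : List Γ} {crs : List Q} (ζ : M.PartComputation w crs) :
    ζ.length = ∑ k ∈ Finset.Ioc (0 : ℤ) w.length,
      (if k < w.length then ζ.crossingSeq k else crs).length := by
  have hw := (ζ.cfg 0).head.isLt
  obtain ⟨n, hn⟩ : ∃ n, w.length = n + 1 := ⟨w.length - 1, by omega⟩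
  rw [PartComputation.length, sum_Ioc_zero_natCast, hn, Finset.sum_range_succ,
    Finset.sum_Ico_eq_sum_range]
  congr 1
  · refine Finset.sum_congr rfl fun i hi => ?_
    have := Finset.mem_range.1 hi
    rw [if_pos (by push_cast; omega), Nat.cast_add, Nat.cast_one, add_comm]
  · simp

lemma PartComputation.exists_partMatches {w : List Γ} {crs : List Q}
    (ζ : M.PartComputation w crs) :
    ∃ c : ℤ → List Q, PartMatches M w c ∧ c 0 = crs ∧ c w.length = crs ∧
      ∑ k ∈ Finset.Ioc (0 : ℤ) w.length, (c k).length = ζ.length := by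
  have hw := (ζ.cfg 0).head.isLt
  refine ⟨withEnds w.length crs crs ζ.crossingSeq, fun k hk => ?_, by simp [withEnds], ?_, ?_⟩
  · have hr := cellRun_of_partSteps ζ.step ζ.ends ⟨k, hk⟩
    have hc : (fun i => crossings (fun s => ((ζ.cfg s).head : ℕ)) (fun s => (ζ.cfg s).state) i
      ζ.last) = ζ.crossingSeq := rfl
    rw [hc, ζ.start_word, ζ.start_head, ζ.start_right, headPos] at hr
    rcases Nat.eq_zero_or_pos k with rfl | hk0
    · simp only [withEnds] at hr ⊢
      norm_num at hr ⊢
      have := CellRun.enterLeft hr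
      rwa [← ζ.start_left] at this
    · simp (disch := omega) only [withEnds, if_pos, if_neg] at hr ⊢
      exact hr
  · simp (disch := omega) only [withEnds, if_pos, if_neg]
  · rw [ζ.length_eq]
    refine Finset.sum_congr rfl fun k hk => ?_
    rw [Finset.mem_Ioc] at hk
    by_cases h : k < w.length
    · simp (disch := omega) only [withEnds, if_pos, if_neg]
    · simp (disch := omega) only [withEnds, if_pos, if_neg]

/-- Crossing sequences that match on every cell of a part come from a run on the part. As the
number of crossings ahead on the two ends is odd, the run leaves the part in the end. -/
lemma exists_partRun {n : ℕ} {crs : List Q} (A : PartCfg Q Γ n) (c : ℤ → List Q)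
    (h0 : c 0 = A.left) (hn : c n = A.right)
    (hm : ∀ k : Fin n, CellRun M (A.word k) (headPos (A.head : ℕ) A.state (k : ℕ))
      (c (k : ℕ)) (c ((k : ℕ) + 1)))
    (hodd : Odd (A.left.length + A.right.length)) (hl : A.left <:+ crs) (hr : A.right <:+ crs) :
    ∃ (t : ℕ) (cfg : ℕ → PartCfg Q Γ n), cfg 0 = A ∧
      (∀ s < t, M.PartStep (cfg s) (cfg (s + 1))) ∧ M.PartEnds crs (cfg t) ∧
      ∀ k : ℤ, 0 < k → k < n →
        crossings (fun s => ((cfg s).head : ℕ)) (fun s => (cfg s).state) k t = c k := by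
  induction hN : ∑ k ∈ Finset.Icc (0 : ℤ) n, (c k).length using Nat.strong_induction_on
    generalizing A c with
  | _ N ih =>
  have hA := A.head.isLt
  have hself := hm A.head
  rw [headPos, if_neg (lt_irrefl _), if_neg (lt_irrefl _)] at hself
  have nil_right (h : c ((A.head : ℕ) + 1) = []) (k : ℤ) (hk : (A.head : ℕ) + 1 ≤ k)
      (hkn : k ≤ n) : c k = [] := by
    refine eq_nil_of_left (M := M) (fun j hj hjn => ?_) h hk hkn
    lift j to ℕ using (by omega : 0 ≤ j)
    have := hm ⟨j, by omega⟩
    simp (disch := omega) only [headPos, if_pos] at this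
    exact ⟨_, this⟩
  have nil_left (h : c (A.head : ℕ) = []) (k : ℤ) (hk : k ≤ (A.head : ℕ))
      (hkn : 0 ≤ k) : c k = [] := by
    refine eq_nil_of_right (M := M) (fun j hj hjn => ?_) h hk hkn
    obtain ⟨j, rfl⟩ := Int.eq_ofNat_of_zero_le hj
    have := hm ⟨j, by omega⟩
    simp (disch := omega) only [headPos, if_pos, if_neg] at this
    exact ⟨_, this⟩
  -- A run from the next configuration `B` becomes a run from `A`.
  have prepend (B : PartCfg Q Γ n) (hstep : M.PartStep A B) (c' : ℤ → List Q)
      (hc' : ∀ k : ℤ, 0 < k → k < n → c k = crossing k (A.head : ℕ) (B.head : ℕ) B.state ++ c' k)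
      (hB : ∃ (t : ℕ) (cfg : ℕ → PartCfg Q Γ n), cfg 0 = B ∧
        (∀ s < t, M.PartStep (cfg s) (cfg (s + 1))) ∧ M.PartEnds crs (cfg t) ∧
        ∀ k : ℤ, 0 < k → k < n →
          crossings (fun s => ((cfg s).head : ℕ)) (fun s => (cfg s).state) k t = c' k) :
      ∃ (t : ℕ) (cfg : ℕ → PartCfg Q Γ n), cfg 0 = A ∧
        (∀ s < t, M.PartStep (cfg s) (cfg (s + 1))) ∧ M.PartEnds crs (cfg t) ∧
        ∀ k : ℤ, 0 < k → k < n →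
          crossings (fun s => ((cfg s).head : ℕ)) (fun s => (cfg s).state) k t = c k := by
    obtain ⟨t, cfg, rfl, hs, he, hcr⟩ := hB
    refine ⟨t + 1, fun s => Nat.casesOn s A cfg, rfl, ?_, he, fun k h1 h2 => ?_⟩
    · rintro (_ | s) h
      · exact hstep
      · exact hs s (by omega)
    · rw [crossings_succ, hc' k h1 h2, ← hcr k h1 h2]
      rfl
  rcases hself.exists_step (h := (A.head : ℕ)) with ⟨hl0, hr0⟩ | ⟨p, b, d, u, v, hδ, hu, hv, hrun⟩
  · exfalso
    rw [← h0, ← hn, nil_left hl0 0 (by omega) le_rfl, nil_right hr0 n (by omega) le_rfl] at hodd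
    simp at hodd
  obtain ⟨c', hc'⟩ : ∃ c' : ℤ → List Q, c' = fun k : ℤ => if k = (A.head : ℕ) then u else
    if k = (A.head : ℕ) + 1 then v else c k := ⟨_, rfl⟩
  have hc : ∀ k, c k = crossing k (A.head : ℕ) ((A.head : ℕ) + d) p ++ c' k := by
    rw [hc']
    exact eq_crossing_append hu hv
  by_cases hin : 0 ≤ ((A.head : ℕ) : ℤ) + d ∧ ((A.head : ℕ) : ℤ) + d < n
  · -- A step inside the part.
    let j : Fin n := ⟨(((A.head : ℕ) : ℤ) + d).toNat, by omega⟩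
    have hj : ((j : ℕ) : ℤ) = ((A.head : ℕ) : ℤ) + d := by simp [j, hin.1]
    have hd : (d : ℤ) = 1 ∨ (d : ℤ) = -1 := by
      rcases Int.units_eq_one_or d with rfl | rfl <;> simp
    let B : PartCfg Q Γ n := ⟨A.left, Function.update A.word A.head b, j, p, A.right⟩
    have h0' : c' 0 = A.left := by
      rw [← h0, hc 0, crossing_eq, if_neg (by omega), List.nil_append]
    have hn' : c' n = A.right := by
      rw [← hn, hc n, crossing_eq, if_neg (by omega), List.nil_append]
    refine prepend B (.inl ⟨b, d, hδ, hj, rfl, rfl, rfl⟩) c' (fun k _ _ => ?_)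
      (ih _ ?_ B c' h0' hn' (fun k => ?_) hodd hl hr rfl)
    · rw [hc k, ← hj]
    · rw [← hN]
      simp only [hc]
      rw [sum_length_crossing (by simp; omega)]
      exact Nat.lt_succ_self _
    · by_cases hk : k = A.head
      · subst hk
        simpa [B, hj, hc'] using hrun
      · have := hm k
        rw [hc, hc ((k : ℕ) + 1)] at this
        have hne : ((k : ℕ) : ℤ) ≠ (A.head : ℕ) := fun h => hk (Fin.ext (by omega))
        simpa [B, hk, hj] using this.of_cons_step rfl hne
  rcases Int.units_eq_one_or d with rfl | rfl
  · -- The head leaves to the right.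
    have hhead : (A.head : ℕ) + 1 = n := by simp at hin; omega
    have hhead' : ((A.head : ℕ) : ℤ) + 1 = n := by omega
    have hr1 : A.right = p :: v := by
      rw [← hn, ← hhead', hv, crossing_right, if_pos rfl]; rfl
    have hu1 : c (A.head : ℕ) = u := by
      rw [hu, crossing_right, if_neg (by omega)]; rfl
    simp (disch := omega) only [headPos, if_pos, if_neg, Units.val_one] at hrun
    cases v with
    | nil =>
      have hl1 : A.left = [] := by
        rw [← h0]
        exact nil_left (hu1.trans hrun.left_eq_nil) 0 (by omega) le_rfl
      refine ⟨0, fun _ => A, rfl, by simp, ⟨p, b, ?_, .inr ⟨hl1, hhead, hr1, hδ⟩⟩,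
        fun k h1 h2 => ?_⟩
      · rw [hr1] at hr
        obtain ⟨x, rfl⟩ := hr
        simp
      · rw [crossings_zero, nil_left (hu1.trans hrun.left_eq_nil) k (by omega) (by omega)]
    | cons p' v' =>
      replace hrun : CellRun M b (.inside p') u v' := by
        cases hrun
        assumption
      let B : PartCfg Q Γ n := ⟨A.left, Function.update A.word A.head b, A.head, p', v'⟩
      refine prepend B (.inr (.inr ⟨p, b, hhead, rfl, hr1, rfl, hδ, rfl⟩))
        (fun k => if k = n then v' else c k) (fun k _ _ => ?_)
        (ih _ ?_ B _ ?_ ?_ (fun k => ?_) ?_ hl ?_ rfl)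
      · rw [crossing_self, if_neg (by omega), List.nil_append]
      · rw [← hN]
        refine Finset.sum_lt_sum (fun k _ => ?_) ⟨n, by simp, ?_⟩
        · split_ifs with h
          · rw [h, hn, hr1]; simp; omega
          · rfl
        · rw [if_pos rfl, hn, hr1]; simp
      · rw [if_neg (by omega), h0]
      · rw [if_pos rfl]
      · by_cases hk : k = A.head
        · subst hk
          simp (disch := omega) only [B, headPos, if_pos, if_neg, Function.update_self, hu1]
          exact hrun
        · have hne : (k : ℕ) ≠ (A.head : ℕ) := fun h => hk (Fin.ext h)
          have := hm k
          simp (disch := omega) only [B, if_neg, Function.update_of_ne hk]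
          simp (disch := omega) only [headPos, if_pos, if_neg] at this ⊢
          exact this
      · rw [hr1] at hodd
        simp only [List.length_cons, B] at hodd ⊢
        rw [Nat.odd_iff] at hodd ⊢
        omega
      · refine List.IsSuffix.trans ?_ hr
        rw [hr1]
        exact ⟨[p, p'], rfl⟩
  · -- The head leaves to the left.
    have hhead : (A.head : ℕ) = 0 := by simp at hin; omega
    have hhead' : ((A.head : ℕ) : ℤ) = 0 := by omega
    have hl1 : A.left = p :: u := by
      rw [← h0, ← hhead', hu, crossing_left, if_pos rfl]; rfl
    have hv1 : c ((A.head : ℕ) + 1) = v := by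
      rw [hv, crossing_left, if_neg (by omega)]; rfl
    simp (disch := omega) only [headPos, if_pos, Units.val_neg, Units.val_one] at hrun
    cases u with
    | nil =>
      have hr1 : A.right = [] := by
        rw [← hn]
        exact nil_right (hv1.trans hrun.right_eq_nil) n (by omega) le_rfl
      refine ⟨0, fun _ => A, rfl, by simp, ⟨p, b, ?_, .inl ⟨hl1, hhead, hr1, hδ⟩⟩,
        fun k h1 h2 => ?_⟩
      · rw [hl1] at hl
        obtain ⟨x, rfl⟩ := hl
        simp
      · rw [crossings_zero, nil_right (hv1.trans hrun.right_eq_nil) k (by omega) (by omega)]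
    | cons p' u' =>
      replace hrun : CellRun M b (.inside p') u' v := by
        cases hrun
        assumption
      let B : PartCfg Q Γ n := ⟨u', Function.update A.word A.head b, A.head, p', A.right⟩
      refine prepend B (.inr (.inl ⟨p, b, hhead, rfl, hl1, rfl, hδ, rfl⟩))
        (fun k => if k = 0 then u' else c k) (fun k _ _ => ?_)
        (ih _ ?_ B _ ?_ ?_ (fun k => ?_) ?_ ?_ hr rfl)
      · rw [crossing_self, if_neg (by omega), List.nil_append]
      · rw [← hN]
        refine Finset.sum_lt_sum (fun k _ => ?_) ⟨0, by simp, ?_⟩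
        · split_ifs with h
          · rw [h, h0, hl1]; simp; omega
          · rfl
        · rw [if_pos rfl, h0, hl1]; simp
      · rw [if_pos rfl]
      · rw [if_neg (by omega), hn]
      · by_cases hk : k = A.head
        · subst hk
          simp (disch := omega) only [B, headPos, if_pos, if_neg, Function.update_self, hv1]
          exact hrun
        · have hne : (k : ℕ) ≠ (A.head : ℕ) := fun h => hk (Fin.ext h)
          have := hm k
          simp (disch := omega) only [B, if_neg, Function.update_of_ne hk]
          simp (disch := omega) only [headPos, if_pos] at this ⊢
          exact this
      · rw [hl1] at hodd
        simp only [List.length_cons, B] at hodd ⊢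
        rw [Nat.odd_iff] at hodd ⊢
        omega
      · refine List.IsSuffix.trans ?_ hl
        rw [hl1]
        exact ⟨[p, p'], rfl⟩

lemma PartMatches.exists_partComputation {w : List Γ} {c : ℤ → List Q} {crs : List Q}
    (hm : PartMatches M w c) (hw : 0 < w.length) (hne : crs ≠ []) (hc0 : c 0 = crs)
    (hc : c w.length = crs) :
    ∃ ζ : M.PartComputation w crs,
      ζ.length = ∑ k ∈ Finset.Ioc (0 : ℤ) w.length, (c k).length := by
  subst hc0
  obtain ⟨p, u, hpu⟩ := List.exists_cons_of_ne_nil hne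
  let A : PartCfg Q Γ w.length := ⟨u, w.get, ⟨0, hw⟩, p, c 0⟩
  have hfirst := hm 0 hw
  rw [Nat.cast_zero, hpu] at hfirst
  have hfirst' : CellRun M w[0] (.inside p) u (c (0 + 1)) := by
    cases hfirst
    assumption
  obtain ⟨t, cfg, h0, hs, he, hcr⟩ := exists_partRun (M := M) (crs := c 0) A
    (fun k => if k = 0 then u else c k) (by simp [A])
    (by rw [if_neg (by omega), hc])
    (by
      intro k
      rcases Nat.eq_zero_or_pos (k : ℕ) with hk | hk
      · obtain rfl : k = ⟨0, hw⟩ := Fin.ext hk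
        simpa [A, headPos] using hfirst'
      · have := hm k k.isLt
        simpa (disch := omega) only [A, headPos, if_pos, if_neg, List.get_eq_getElem] using this)
    (by simp only [A, hpu, List.length_cons]; rw [Nat.odd_iff]; omega)
    (by rw [hpu]; exact List.suffix_cons _ _) (List.suffix_refl _)
  refine ⟨⟨t, cfg, by simp [h0, A], by simp [h0, A], by simp [h0, A, hpu], by simp [h0, A], hs, he⟩,
    ?_⟩
  rw [PartComputation.length_eq]
  refine Finset.sum_congr rfl fun k hk => ?_
  rw [Finset.mem_Ioc] at hk
  split_ifs with h
  · have := hcr k (by omega) h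
    rw [if_neg (by omega)] at this
    rw [← this]
    rfl
  · rw [show k = w.length by omega, hc]

/-! ### Cutting out and inserting a part -/

lemma startCfg_tape_natCast (w : List Γ) (k : ℕ) :
    (M.startCfg w).tape k = w.getD k M.blank := by
  simp [startCfg]

/-- The matching condition for a starting configuration, sorted by the side of the cell on which
the head starts. -/
lemma matches_startCfg_iff {w : List Γ} {c : ℤ → List Q} :
    Matches M (M.startCfg w) c ↔ (∀ k < 0, CellRun M M.blank .right (c k) (c (k + 1))) ∧
      CellRun M (w.getD 0 M.blank) (.inside M.q₀) (c 0) (c 1) ∧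
      ∀ k : ℕ, 0 < k → CellRun M (w.getD k M.blank) .left (c k) (c (k + 1)) := by
  have hneg (k : ℤ) (hk : k < 0) : headPos (M.startCfg w).head (M.startCfg w).state k = .right := by
    rw [headPos, if_neg (by simpa [startCfg] using hk.le), if_pos (by simpa [startCfg] using hk)]
  have hzero : headPos (M.startCfg w).head (M.startCfg w).state 0 = .inside M.q₀ := by
    simp [startCfg, headPos]
  have hpos (k : ℕ) (hk : 0 < k) :
      headPos (M.startCfg w).head (M.startCfg w).state k = .left := by
    simp [startCfg, headPos, hk]
  have hblank (k : ℤ) (hk : k < 0) : (M.startCfg w).tape k = M.blank := by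
    simp only [startCfg]
    rw [if_neg (by omega)]
  constructor
  · intro h
    refine ⟨fun k hk => ?_, ?_, fun k hk => ?_⟩
    · simpa [hneg k hk, hblank k hk] using h k
    · have := h 0
      rw [hzero, ← Nat.cast_zero, startCfg_tape_natCast] at this
      simpa using this
    · rw [← hpos k hk, ← startCfg_tape_natCast]
      exact h k
  · rintro ⟨h1, h2, h3⟩ k
    rcases lt_trichotomy k 0 with hk | rfl | hk
    · rw [hneg k hk, hblank k hk]
      exact h1 k hk
    · rw [hzero, ← Nat.cast_zero, startCfg_tape_natCast]
      simpa using h2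
    · lift k to ℕ using hk.le
      rw [hpos k (by omega), startCfg_tape_natCast]
      exact h3 k (by omega)

/-- The family that remains of `f` when the boundaries `i + 1, …, i + m` are removed. -/
def cutOut {α : Type*} (f : ℤ → α) (i m : ℕ) (k : ℤ) : α := if k ≤ i then f k else f (k + m)

lemma sum_Ioc_int_consecutive (g : ℤ → ℕ) {x y z : ℤ} (h1 : x ≤ y) (h2 : y ≤ z) :
    ∑ k ∈ Finset.Ioc x z, g k = ∑ k ∈ Finset.Ioc x y, g k + ∑ k ∈ Finset.Ioc y z, g k := by
  rw [← Finset.Ioc_union_Ioc_eq_Ioc h1 h2, Finset.sum_union (Finset.Ioc_disjoint_Ioc_of_le le_rfl)]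

lemma sum_cutOut (f : ℤ → ℕ) {i m : ℕ} {a b : ℤ} (ha : a ≤ i) (hb : (i + m : ℤ) ≤ b) :
    ∑ k ∈ Finset.Ioc a b, f k =
      ∑ k ∈ Finset.Ioc a (b - m), cutOut f i m k + ∑ k ∈ Finset.Ioc (i : ℤ) (i + m), f k := by
  rw [sum_Ioc_int_consecutive f ha (by omega : (i : ℤ) ≤ b),
    sum_Ioc_int_consecutive f (by omega : (i : ℤ) ≤ i + m) hb,
    sum_Ioc_int_consecutive (cutOut f i m) ha (by omega : (i : ℤ) ≤ b - m)]
  have e1 : ∑ k ∈ Finset.Ioc a (i : ℤ), cutOut f i m k = ∑ k ∈ Finset.Ioc a (i : ℤ), f k :=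
    Finset.sum_congr rfl fun k hk => if_pos (Finset.mem_Ioc.1 hk).2
  have e2 : ∑ k ∈ Finset.Ioc (i : ℤ) (b - m), cutOut f i m k =
      ∑ k ∈ Finset.Ioc ((i : ℤ) + m) b, f k := by
    have := Finset.map_add_right_Ioc (i : ℤ) (b - m) m
    rw [sub_add_cancel] at this
    rw [← this, Finset.sum_map]
    exact Finset.sum_congr rfl fun k hk => if_neg (by rw [Finset.mem_Ioc] at hk; omega)
  rw [e1, e2]
  omega

lemma length_cutOut (c : ℤ → List Q) (i m : ℕ) (k : ℤ) :
    (cutOut c i m k).length = cutOut (fun k => (c k).length) i m k := by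
  unfold cutOut
  split_ifs <;> rfl

lemma HasTotal.cut {c : ℤ → List Q} {t : ℕ} (h : HasTotal c t) (i m : ℕ) :
    ∃ t', HasTotal (cutOut c i m) t' ∧
      t = t' + ∑ k ∈ Finset.Ioc (i : ℤ) (i + m), (c k).length := by
  obtain ⟨a, ha, b, hb, h0, rfl⟩ := h.exists_window i (i + m)
  refine ⟨_, ⟨a, b - m, fun k hk => ?_, rfl⟩, ?_⟩
  · unfold cutOut
    split_ifs with h <;> exact h0 _ (by omega)
  · simp only [length_cutOut]
    exact sum_cutOut _ ha hb

lemma HasTotal.of_cutOut {c : ℤ → List Q} {t i m : ℕ} (h : HasTotal (cutOut c i m) t) :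
    HasTotal c (t + ∑ k ∈ Finset.Ioc (i : ℤ) (i + m), (c k).length) := by
  obtain ⟨a, ha, b, hb, h0, rfl⟩ := h.exists_window i (i + m)
  refine ⟨a, b + m, fun k hk => ?_, ?_⟩
  · rcases hk with hk | hk
    · have := h0 k (.inl hk)
      rwa [cutOut, if_pos (by omega)] at this
    · have := h0 (k - m) (.inr (by omega))
      rwa [cutOut, if_neg (by omega), sub_add_cancel] at this
  · simp only [length_cutOut]
    rw [sum_cutOut _ ha (by omega : (i + m : ℤ) ≤ b + m), add_sub_cancel_right]

/-- A part between two boundaries with the same crossing sequence can be cut out. -/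
lemma Realizes.cut {w : List Γ} {c : ℤ → List Q} {t i m : ℕ} (h : Realizes M w c t)
    (hi : 1 ≤ i) (him : i + m ≤ w.length) (hc : c i = c (i + m)) :
    ∃ t', Realizes M (w.take i ++ w.drop (i + m)) (cutOut c i m) t' ∧
      t = t' + ∑ k ∈ Finset.Ioc (i : ℤ) (i + m), (c k).length := by
  obtain ⟨t', ht', ht⟩ := h.hasTotal.cut i m
  refine ⟨t', ⟨?_, ht'⟩, ht⟩
  obtain ⟨h1, h2, h3⟩ := matches_startCfg_iff.1 h.matches_start
  have hlow (k : ℤ) (hk : k ≤ i) : cutOut c i m k = c k := if_pos hk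
  have hhigh (k : ℤ) (hk : i ≤ k) : cutOut c i m k = c (k + m) := by
    rcases hk.eq_or_lt with rfl | hk
    · rw [hlow _ le_rfl, hc]
    · exact if_neg hk.not_ge
  have glow (k : ℕ) (hk : k < i) : (w.take i ++ w.drop (i + m)).getD k M.blank =
      w.getD k M.blank := by
    have : k < (w.take i).length := by simp; omega
    rw [List.getD_append _ _ _ _ this, List.getD_eq_getElem?_getD, List.getElem?_take_of_lt hk,
      List.getD_eq_getElem?_getD]
  have ghigh (k : ℕ) (hk : i ≤ k) : (w.take i ++ w.drop (i + m)).getD k M.blank =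
      w.getD (k + m) M.blank := by
    have e : (w.take i).length = i := by simp; omega
    rw [List.getD_eq_getElem?_getD, List.getElem?_append_right (by omega), e,
      List.getElem?_drop, List.getD_eq_getElem?_getD]
    congr 2
    omega
  refine matches_startCfg_iff.2 ⟨fun k hk => ?_, ?_, fun k hk => ?_⟩
  · rw [hlow k (by omega), hlow (k + 1) (by omega)]
    exact h1 k hk
  · rw [hlow 0 (by omega), hlow 1 (by omega), glow 0 (by omega)]
    exact h2
  · rcases lt_or_ge k i with hki | hki
    · rw [hlow k (by omega), hlow (k + 1) (by omega), glow k hki]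
      exact h3 k hk
    · rw [hhigh k (by omega), hhigh (k + 1) (by omega), ghigh k hki]
      have := h3 (k + m) (by omega)
      push_cast at this
      rwa [add_right_comm]

lemma Realizes.partMatches {w : List Γ} {c : ℤ → List Q} {t i m : ℕ} (h : Realizes M w c t)
    (hi : 1 ≤ i) (him : i + m ≤ w.length) :
    PartMatches M ((w.drop i).take m) fun k => c (i + k) := by
  intro k hk
  rw [List.length_take, List.length_drop] at hk
  have := (matches_startCfg_iff.1 h.matches_start).2.2 (i + k) (by omega)
  rw [List.getD_eq_getElem _ _ (by omega)] at this
  simpa [add_assoc] using this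

/-- On a boundary with crossing sequence `crs` one may insert a part with ending crossing
sequence `crs`. -/
lemma Realizes.insert {u v x : List Γ} {c g : ℤ → List Q} {t : ℕ} (h : Realizes M (u ++ v) c t)
    (hu : 1 ≤ u.length) (hx : PartMatches M x g) (h0 : g 0 = c u.length)
    (hg : g x.length = c u.length) :
    ∃ c', Realizes M (u ++ (x ++ v)) c'
        (t + ∑ k ∈ Finset.Ioc (0 : ℤ) x.length, (g k).length) ∧
      c' u.length = c u.length := by
  obtain ⟨h1, h2, h3⟩ := matches_startCfg_iff.1 h.matches_start
  set i := u.length with hi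
  set m := x.length with hm
  let c' : ℤ → List Q := fun k => if k ≤ i then c k else if k ≤ i + m then g (k - i) else c (k - m)
  have hlow (k : ℤ) (hk : k ≤ i) : c' k = c k := if_pos hk
  have hmid (k : ℤ) (hk : i ≤ k) (hk' : k ≤ i + m) : c' k = g (k - i) := by
    rcases hk.eq_or_lt with rfl | hk
    · rw [hlow _ le_rfl, sub_self, h0]
    · simp only [c']
      rw [if_neg hk.not_ge, if_pos hk']
  have hhigh (k : ℤ) (hk : i + m ≤ k) : c' k = c (k - m) := by
    rcases hk.eq_or_lt with rfl | hk
    · rw [hmid _ (by omega) le_rfl, add_sub_cancel_left, hg, add_sub_cancel_right]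
    · simp only [c']
      rw [if_neg (by omega), if_neg hk.not_ge]
  refine ⟨c', ⟨?_, ?_⟩, hlow _ le_rfl⟩
  · refine matches_startCfg_iff.2 ⟨fun k hk => ?_, ?_, fun k hk => ?_⟩
    · rw [hlow k (by omega), hlow (k + 1) (by omega)]
      exact h1 k hk
    · rw [hlow 0 (by omega), hlow 1 (by omega)]
      rw [List.getD_append _ _ _ _ (by omega)] at h2 ⊢
      exact h2
    · rcases lt_or_ge k i with hki | hki
      · have := h3 k hk
        rw [List.getD_append _ _ _ _ (by omega)] at this ⊢
        rwa [hlow k (by omega), hlow (k + 1) (by omega)]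
      rw [List.getD_append_right _ _ _ _ (by omega), ← hi]
      rcases lt_or_ge k (i + m) with hkm | hkm
      · rw [List.getD_append _ _ _ _ (by omega), List.getD_eq_getElem _ _ (by omega),
          hmid k (by omega) (by omega), hmid (k + 1) (by omega) (by omega)]
        have := hx (k - i) (by omega)
        rwa [Nat.cast_sub hki, sub_add_eq_add_sub] at this
      · rw [List.getD_append_right _ _ _ _ (by omega), ← hm, hhigh k (by omega),
          hhigh (k + 1) (by omega)]
        have := h3 (k - m) (by omega)
        rwa [List.getD_append_right _ _ _ _ (by omega), ← hi, Nat.cast_sub (by omega),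
          sub_add_eq_add_sub, Nat.sub_right_comm] at this
  · have hcut : cutOut c' i m = c := by
      funext k
      unfold cutOut
      split_ifs with hk
      · exact hlow k hk
      · rw [hhigh _ (by omega), add_sub_cancel_right]
    have ht := h.hasTotal
    rw [← hcut] at ht
    have hsum : ∑ k ∈ Finset.Ioc (0 : ℤ) m, (g k).length =
        ∑ k ∈ Finset.Ioc (i : ℤ) (i + m), (c' k).length := by
      have := Finset.map_add_right_Ioc (0 : ℤ) m i
      rw [zero_add, add_comm (m : ℤ)] at this
      rw [← this, Finset.sum_map]
      refine Finset.sum_congr rfl fun k hk => ?_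
      rw [Finset.mem_Ioc] at hk
      rw [addRightEmbedding_apply, hmid _ (by omega) (by omega), add_sub_cancel_right]
    rw [hsum]
    exact ht.of_cutOut

/-! ### Counting short crossing sequences -/

/-- The total amount `∑ (C + 1 - |u|)`, over all lists `u` of length at most `C` on `q` letters, by
which these lists are shorter than `C + 1`. -/
def shortWeight (q C : ℕ) : ℕ := ∑ j ∈ Finset.range (C + 1), q ^ j * (C + 1 - j)

lemma four_mul_shortWeight_le {q : ℕ} (hq : 3 ≤ q) (C : ℕ) :
    4 * shortWeight q C + 2 * C + 5 ≤ 9 * q ^ C := by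
  induction C with
  | zero => simp [shortWeight]
  | succ C ih =>
    have h : shortWeight q (C + 1) = q * shortWeight q C + (C + 2) := by
      unfold shortWeight
      rw [Finset.sum_range_succ', Finset.mul_sum, pow_zero, one_mul]
      congr 1
      refine Finset.sum_congr rfl fun j _ => ?_
      rw [Nat.add_sub_add_right, pow_succ]
      ring
    rw [h, pow_succ]
    nlinarith [Nat.mul_le_mul_left q ih]

/-- Distinct crossing sequences are long on average: there are only `q ^ j` lists of length `j`. -/
lemma mul_card_le_of_injOn [Fintype Q] {s : Finset ℤ} {f : ℤ → List Q} (hf : Set.InjOn f s)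
    (C : ℕ) :
    (C + 1) * s.card ≤ ∑ k ∈ s, (f k).length + shortWeight (Fintype.card Q) C := by
  classical
  have hfib (j : ℕ) : (s.filter fun k => (f k).length = j).card ≤ Fintype.card Q ^ j := by
    rw [← card_vector, ← Finset.card_univ]
    refine le_trans (Finset.card_le_card_of_injOn
      (t := (Finset.univ : Finset (List.Vector Q j)).image List.Vector.toList) f (fun k hk => ?_)
      (hf.mono (Finset.coe_subset.2 (Finset.filter_subset _ _)))) Finset.card_image_le
    rw [Finset.mem_coe, Finset.mem_filter] at hk
    exact Finset.mem_image.2 ⟨(⟨f k, hk.2⟩ : List.Vector Q j), Finset.mem_univ _, rfl⟩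
  have hshort : ∑ k ∈ s, (C + 1 - (f k).length) ≤ shortWeight (Fintype.card Q) C := by
    calc ∑ k ∈ s, (C + 1 - (f k).length)
        = ∑ k ∈ s with (f k).length ∈ Finset.range (C + 1), (C + 1 - (f k).length) := by
          refine (Finset.sum_filter_of_ne fun k _ hk => ?_).symm
          rw [Finset.mem_range]
          omega
      _ = ∑ j ∈ Finset.range (C + 1), ∑ k ∈ s with (f k).length = j, (C + 1 - (f k).length) := by
          rw [Finset.sum_fiberwise_eq_sum_filter]
      _ ≤ shortWeight (Fintype.card Q) C := by
          refine Finset.sum_le_sum fun j _ => ?_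
          rw [Finset.sum_congr rfl (g := fun _ => C + 1 - j) fun k hk => by
            rw [(Finset.mem_filter.1 hk).2], Finset.sum_const, smul_eq_mul]
          exact Nat.mul_le_mul_right _ (hfib j)
  calc (C + 1) * s.card = ∑ _k ∈ s, (C + 1) := by rw [Finset.sum_const, smul_eq_mul, mul_comm]
    _ ≤ ∑ k ∈ s, ((f k).length + (C + 1 - (f k).length)) :=
        Finset.sum_le_sum fun k _ => by omega
    _ ≤ _ := by
        rw [Finset.sum_add_distrib]
        omega

lemma mul_le_of_forall_ne [Fintype Q] {f : ℤ → List Q} {x : ℤ} {n : ℕ}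
    (h : ∀ a b, x < a → a < b → b ≤ x + n → f a ≠ f b) (C : ℕ) :
    (C + 1) * n ≤ ∑ k ∈ Finset.Ioc x (x + n), (f k).length +
      shortWeight (Fintype.card Q) C := by
  have hinj : Set.InjOn f (Finset.Ioc x (x + n)) := by
    intro a ha b hb hab
    simp only [Finset.coe_Ioc, Set.mem_Ioc] at ha hb
    rcases lt_trichotomy a b with hlt | rfl | hlt
    · exact (h a b ha.1 hlt hb.2 hab).elim
    · rfl
    · exact (h b a hb.1 hlt ha.2 hab.symm).elim
  simpa using mul_card_le_of_injOn hinj C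

/-- If equal crossing sequences are always more than `r` boundaries apart, then every `r + 1`
consecutive boundaries have distinct ones. -/
lemma mul_add_min_le_of_forall_ne [Fintype Q] {f : ℤ → List Q} {C r : ℕ}
    (hr : shortWeight (Fintype.card Q) C ≤ r + 1) {n : ℕ} {x : ℤ}
    (h : ∀ a b, x < a → a < b → b ≤ x + n → b - a ≤ r → f a ≠ f b) :
    C * n + min n (r + 1 - shortWeight (Fintype.card Q) C) ≤
      ∑ k ∈ Finset.Ioc x (x + n), (f k).length + shortWeight (Fintype.card Q) C := by
  induction n using Nat.strong_induction_on generalizing x with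
  | _ n ih =>
  rcases le_or_gt n (r + 1) with hn | hn
  · have := mul_le_of_forall_ne (f := f) (x := x) (n := n)
      (fun a b h1 h2 h3 => h a b h1 h2 h3 (by omega)) C
    rw [add_mul, one_mul] at this
    omega
  · have hfirst := mul_le_of_forall_ne (f := f) (x := x) (n := r + 1)
      (fun a b h1 h2 h3 => h a b h1 h2 (by omega) (by omega)) C
    have hrest := ih (n - (r + 1)) (by omega) (x := x + (r + 1 : ℕ))
      (fun a b h1 h2 h3 h4 => h a b (by omega) h2 (by omega) h4)
    rw [show x + (r + 1 : ℕ) + (n - (r + 1) : ℕ) = x + n by omega] at hrest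
    rw [sum_Ioc_int_consecutive _ (by omega : x ≤ x + (r + 1 : ℕ))
      (by omega : x + (r + 1 : ℕ) ≤ x + n)]
    obtain ⟨d, rfl⟩ : ∃ d, n = (r + 1) + d := ⟨n - (r + 1), by omega⟩
    rw [add_tsub_cancel_left] at hrest
    rw [add_mul, one_mul] at hfirst
    rw [mul_add]
    omega

/-! ### The compactness argument -/

lemma IsInput.take_append_drop {w : List Γ} (h : M.IsInput w) (i j : ℕ) :
    M.IsInput (w.take i ++ w.drop j) := by
  intro a ha
  rcases List.mem_append.1 ha with ha | ha
  · exact h a (List.mem_of_mem_take ha)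
  · exact h a (List.mem_of_mem_drop ha)

lemma Realizes.mem_crossingSet {w : List Γ} {c : ℤ → List Q} {t i : ℕ} (h : Realizes M w c t)
    (hw : M.IsInput w) (hi : 1 ≤ i) (hiw : i ≤ w.length) : c i ∈ M.crossingSet w.length := by
  obtain ⟨ζ, ht, hc⟩ := h.exists_computation
  exact ⟨w, hw, rfl, i, hi, hiw, ζ, t, ht, (hc i).symm⟩

/-- If all shorter inputs obey the time bound and the input `w` exceeds it by at most one, then
every crossing sequence on `w` already appears on a short input: as long as the input is too long,
two boundaries on the same side of `i` have equal crossing sequences, and what lies between them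
can be cut out. -/
lemma Realizes.mem_iUnion_crossingSet [Fintype Q] (hq : 3 ≤ Fintype.card Q) {C D : ℕ}
    {w : List Γ} {c : ℤ → List Q} {t i : ℕ} (h : Realizes M w c t) (hw : M.IsInput w)
    (hi : 1 ≤ i) (hiw : i ≤ w.length) (ht : t ≤ C * w.length + D + 1)
    (hshort : ∀ w' c' t', M.IsInput w' → w'.length < w.length → Realizes M w' c' t' →
      t' ≤ C * w'.length + D) :
    c i ∈ ⋃ n ∈ Set.Icc 1 (D + 8 * Fintype.card Q ^ C), M.crossingSet n := by
  induction hn : w.length using Nat.strong_induction_on generalizing w c t i with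
  | _ n ih =>
  rcases le_or_gt w.length (D + 8 * Fintype.card Q ^ C) with hwl | hwl
  · exact Set.mem_biUnion ⟨by omega, hwl⟩ (h.mem_crossingSet hw hi hiw)
  -- Cutting out the part between two boundaries `a < b` moves boundary `i` to `i'`.
  have step (a b i' : ℕ) (ha : 1 ≤ a) (hab : a < b) (hb : b ≤ w.length) (hc : c a = c b)
      (hi' : 1 ≤ i') (hi'w : i' ≤ w.length - (b - a)) (hci : cutOut c a (b - a) i' = c i) :
      c i ∈ ⋃ n ∈ Set.Icc 1 (D + 8 * Fintype.card Q ^ C), M.crossingSet n := by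
    have hb' : a + (b - a) = b := by omega
    obtain ⟨t', hr, -⟩ := h.cut ha (m := b - a) (by omega)
      (by rw [← Nat.cast_add, hb', hc])
    have hin := hw.take_append_drop a (a + (b - a))
    have hlen : (w.take a ++ w.drop (a + (b - a))).length = w.length - (b - a) := by
      simp
      omega
    have ht' := hshort _ _ _ hin (by omega) hr
    rw [← hci]
    exact ih _ (by omega) hr hin hi' (by omega) (by omega)
      (fun w' c' t' h1 h2 => hshort w' c' t' h1 (by omega)) hlen
  -- Otherwise each sequence occurs at most once up to boundary `i` and at most once after it.
  by_contra hcon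
  have hleft := mul_le_of_forall_ne (f := c) (x := 0) (n := i) (fun a b h1 h2 h3 he => by
    lift a to ℕ using h1.le
    lift b to ℕ using (by omega : 0 ≤ b)
    refine hcon (step a b (i - (b - a)) (by omega) (by omega) (by omega) he (by omega) (by omega) ?_)
    unfold cutOut
    split_ifs with hle
    · obtain rfl : b = i := by omega
      rw [← he]
      congr 1
      omega
    · congr 1
      omega) C
  have hright := mul_le_of_forall_ne (f := c) (x := i) (n := w.length - i)
    (fun a b h1 h2 h3 he => by
      lift a to ℕ using (by omega : 0 ≤ a)
      lift b to ℕ using (by omega : 0 ≤ b)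
      exact hcon (step a b i (by omega) (by omega) (by omega) he hi (by omega)
        (if_pos (by omega)))) C
  have hS := four_mul_shortWeight_le hq C
  have hsum := h.hasTotal.sum_le 0 (i + (w.length - i : ℕ))
  rw [sum_Ioc_int_consecutive _ (by omega : (0 : ℤ) ≤ i) (by omega)] at hsum
  rw [zero_add] at hleft
  obtain ⟨d, hd⟩ : ∃ d, w.length = i + d := ⟨w.length - i, by omega⟩
  rw [hd, add_tsub_cancel_left] at hright hsum
  rw [hd] at ht hwl
  rw [add_mul, one_mul] at hleft hright
  rw [mul_add] at ht
  omega

/-- Inserting `k` copies of a part on a boundary with the matching crossing sequence prolongs the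
run by `k` times the length of the computation on the part. -/
lemma Realizes.exists_insert_iterate {u v x : List Γ} {c g : ℤ → List Q} {t : ℕ}
    (h : Realizes M (u ++ v) c t) (huv : M.IsInput (u ++ v)) (hxi : M.IsInput x)
    (hu : 1 ≤ u.length) (hx : PartMatches M x g) (h0 : g 0 = c u.length)
    (hg : g x.length = c u.length) (k : ℕ) :
    ∃ v' c', M.IsInput (u ++ v') ∧ v'.length = v.length + k * x.length ∧
      c' u.length = c u.length ∧
      Realizes M (u ++ v') c' (t + k * ∑ j ∈ Finset.Ioc (0 : ℤ) x.length, (g j).length) := by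
  induction k with
  | zero => exact ⟨v, c, huv, by simp, rfl, by simpa using h⟩
  | succ k ih =>
    obtain ⟨v', c', hin, hlen, hc', hr⟩ := ih
    obtain ⟨c'', hr', hc''⟩ := hr.insert hu hx (h0.trans hc'.symm) (hg.trans hc'.symm)
    refine ⟨x ++ v', c'', ?_, ?_, hc''.trans hc', ?_⟩
    · intro a ha
      simp only [List.mem_append] at ha
      rcases ha with ha | ha | ha
      · exact hin a (List.mem_append_left _ ha)
      · exact hxi a ha
      · exact hin a (List.mem_append_right _ ha)
    · rw [List.length_append, hlen]
      ring
    · rwa [add_mul, one_mul, ← add_assoc]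

lemma RunsInTime.le_of_realizes {T : ℕ → ℕ} (hM : M.RunsInTime T) {w : List Γ}
    {c : ℤ → List Q} {t : ℕ} (hw : M.IsInput w) (h : Realizes M w c t) : t ≤ T w.length := by
  obtain ⟨ζ, ht, -⟩ := h.exists_computation
  exact_mod_cast ht.trans (hM _ w hw rfl ζ)

/-- A part on which a computation is too long could be inserted into an input as many times as
needed to break the time bound. -/
lemma RunsInTime.partComputation_length_le {C D n : ℕ} (hM : M.RunsInTime fun n => C * n + D)
    {crs : List Q} (hcrs : crs ∈ M.crossingSet n) {x : List Γ} (hx : M.IsInput x)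
    (ζ : M.PartComputation x crs) : ζ.length ≤ C * x.length := by
  obtain ⟨w, hw, rfl, i, hi, hiw, ζ', t, ht, rfl⟩ := hcrs
  obtain ⟨g, hg, hg0, hgn, hsum⟩ := ζ.exists_partMatches
  -- Each copy costs at least one step more than the bound allows for it, so `C * |w| + D + 1`
  -- copies use up the slack.
  have hr : Realizes M (w.take i ++ w.drop i) (fun k => ζ'.crossingSeq k t) t := by
    simpa using ζ'.realizes ht
  have hlen : (w.take i).length = i := by simpa using hiw
  by_contra! hlt
  obtain ⟨v', c', hin, hv', -, hr'⟩ := hr.exists_insert_iterate (by simpa using hw) hx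
    (by omega) hg (by rw [hg0, hlen]) (by rw [hgn, hlen]) (C * w.length + D + 1)
  have := hM.le_of_realizes hin hr'
  rw [List.length_append, hv', hlen, hsum, List.length_drop] at this
  have e : i + (w.length - i + (C * w.length + D + 1) * x.length) =
    w.length + (C * w.length + D + 1) * x.length := by omega
  rw [e] at this
  nlinarith [Nat.mul_le_mul_left (C * w.length + D + 1) hlt]

/-- A computation on a part with crossing sequence `c i` on both ends, cut out of a run. -/
lemma Realizes.exists_partComputation {w : List Γ} {c : ℤ → List Q} {t i m : ℕ}
    (h : Realizes M w c t) (hi : 1 ≤ i) (hm : 0 < m) (him : i + m ≤ w.length)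
    (hc : c i = c (i + m)) (hne : c i ≠ []) :
    ∃ ζ : M.PartComputation ((w.drop i).take m) (c i),
      ζ.length = ∑ k ∈ Finset.Ioc (i : ℤ) (i + m), (c k).length := by
  have hlen : ((w.drop i).take m).length = m := by simp; omega
  have hp := h.partMatches hi him
  obtain ⟨ζ, hζ⟩ := hp.exists_partComputation (by omega) hne (by simp) (by rw [hlen, hc])
  refine ⟨ζ, ?_⟩
  rw [hζ, hlen]
  have := Finset.map_add_right_Ioc (0 : ℤ) m i
  rw [zero_add, add_comm (m : ℤ)] at this
  rw [← this, Finset.sum_map]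
  exact Finset.sum_congr rfl fun k _ => by rw [addRightEmbedding_apply, add_comm]

/-- To the right of a boundary `i ≥ 1` that is never crossed, no boundary is. -/
lemma Realizes.sum_eq_zero {w : List Γ} {c : ℤ → List Q} {t i : ℕ} (h : Realizes M w c t)
    (hi : 1 ≤ i) (hc : c i = []) (b : ℤ) : ∑ k ∈ Finset.Ioc (i : ℤ) b, (c k).length = 0 := by
  refine Finset.sum_eq_zero fun k hk => ?_
  rw [Finset.mem_Ioc] at hk
  rw [List.length_eq_zero_iff]
  refine eq_nil_of_left (M := M) (fun j hj _ => ?_) hc hk.1.le hk.2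
  lift j to ℕ using by omega
  exact ⟨_, (matches_startCfg_iff.1 h.matches_start).2.2 j (by omega)⟩

/-- The time bound on short inputs, together with the bound on short parts with crossing sequences
from short inputs, implies the time bound on all inputs. -/
lemma le_of_short_and_parts [Fintype Q] (hq : 3 ≤ Fintype.card Q) {C D : ℕ}
    (ha : ∀ w : List Γ, M.IsInput w → w.length ≤ D + 8 * Fintype.card Q ^ C →
      ∀ ζ : M.Computation w, ζ.len ≤ ((C * w.length + D : ℕ) : ℕ∞))
    (hb : ∀ crs ∈ ⋃ n ∈ Set.Icc 1 (D + 8 * Fintype.card Q ^ C), M.crossingSet n,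
      ∀ x : List Γ, M.IsInput x → 1 ≤ x.length → x.length ≤ D + 12 * Fintype.card Q ^ C →
        ∀ ζ : M.PartComputation x crs, ζ.length ≤ C * x.length)
    (w : List Γ) (hw : M.IsInput w) (ζ : M.Computation w) :
    ζ.len ≤ ((C * w.length + D : ℕ) : ℕ∞) := by
  induction hn : w.length using Nat.strong_induction_on generalizing w with
  | _ n ih =>
  subst hn
  by_contra! hlt
  have hwl : D + 8 * Fintype.card Q ^ C < w.length := by
    by_contra! hle
    exact (ha w hw hle ζ).not_gt hlt
  have hshort : ∀ w' c' t', M.IsInput w' → w'.length < w.length → Realizes M w' c' t' →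
      t' ≤ C * w'.length + D := by
    intro w' c' t' hw' hl hr
    obtain ⟨ζ', ht', -⟩ := hr.exists_computation
    exact_mod_cast ht'.trans (ih _ hl w' hw' ζ' rfl)
  have ht : ((C * w.length + D + 1 : ℕ) : ℕ∞) ≤ ζ.len := by
    rw [Nat.cast_add, Nat.cast_one]
    exact Order.add_one_le_of_lt hlt
  have hr := ζ.realizes ht
  set c : ℤ → List Q := fun k => ζ.crossingSeq k (C * w.length + D + 1) with hc
  have hS := four_mul_shortWeight_le hq C
  obtain ⟨i, m, hi, hm, him, hmr, heq⟩ : ∃ i m : ℕ, 1 ≤ i ∧ 0 < m ∧ i + m ≤ w.length ∧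
      m ≤ D + 12 * Fintype.card Q ^ C ∧ c i = c (i + m) := by
    by_contra! hcon
    have := mul_add_min_le_of_forall_ne (f := c) (C := C) (r := D + 12 * Fintype.card Q ^ C)
      (by omega) (n := w.length) (x := 0) (fun a b h1 h2 h3 h4 => by
        lift a to ℕ using h1.le
        lift b to ℕ using (by omega : 0 ≤ b)
        have := hcon a (b - a) (by omega) (by omega) (by omega) (by omega)
        rwa [Nat.cast_sub (by omega), add_sub_cancel] at this)
    have hsum := hr.hasTotal.sum_le 0 (0 + w.length)
    omega
  obtain ⟨t', hr', ht'⟩ := hr.cut hi him heq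
  have hpart : ∑ k ∈ Finset.Ioc (i : ℤ) (i + m), (c k).length ≤ C * m := by
    -- There is no computation on a part with the empty crossing sequence, but such a part is never
    -- entered either.
    by_cases hne : c i = []
    · rw [hr.sum_eq_zero hi hne]
      exact Nat.zero_le _
    · obtain ⟨ξ, hξ⟩ := hr.exists_partComputation hi hm him heq hne
      have hlen : ((w.drop i).take m).length = m := by simp; omega
      have := hb _ (hr.mem_iUnion_crossingSet hq hw hi (by omega) le_rfl hshort) _
        (fun a ha => hw a (List.mem_of_mem_drop (List.mem_of_mem_take ha))) (by omega)
        (by omega) ξ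
      rwa [hξ, hlen] at this
  have hlen : (w.take i ++ w.drop (i + m)).length = w.length - m := by
    simp
    omega
  have := hshort _ _ _ (hw.take_append_drop i (i + m)) (by omega) hr'
  rw [hlen] at this
  obtain ⟨d, hd⟩ : ∃ d, w.length = d + m := ⟨w.length - m, by omega⟩
  rw [hd, add_tsub_cancel_right] at this
  rw [hd, mul_add] at ht'
  omega

lemma three_le_card [Fintype Q] (M : OneTapeNTM Q Γ) : 3 ≤ Fintype.card Q := by
  classical
  rw [← Finset.card_eq_three.2 ⟨_, _, _, M.q₀_ne_qa, M.q₀_ne_qr, M.qa_ne_qr, rfl⟩]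
  exact Finset.card_le_univ _

end OneTapeNTM

theorem theorem1 {Q Γ : Type*} [Fintype Q] [Finite Γ] (M : OneTapeNTM Q Γ) (q C D ℓ r : ℕ)
    (hq : Fintype.card Q = q) (hℓ : ℓ = D + 8 * q ^ C) (hr : r = D + 12 * q ^ C) :
    M.RunsInTime (fun n => C * n + D) ↔
      (∀ w : List Γ, M.IsInput w → w.length ≤ ℓ →
        ∀ ζ : M.Computation w, ζ.len ≤ ((C * w.length + D : ℕ) : ℕ∞)) ∧
      (∀ crs ∈ ⋃ n ∈ Set.Icc 1 ℓ, M.crossingSet n,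
        ∀ w : List Γ, M.IsInput w → 1 ≤ w.length → w.length ≤ r →
          0 ≤ M.partTime w crs →
            M.partTime w crs ≤ (((C * w.length : ℕ) : ℕ∞) : WithBot ℕ∞)) := by
  subst hq hℓ hr
  constructor
  · refine fun hM => ⟨fun w hw _ ζ => hM _ w hw rfl ζ, fun crs hcrs w hw _ _ _ => ?_⟩
    simp only [Set.mem_iUnion] at hcrs
    obtain ⟨n, -, hcrs⟩ := hcrs
    refine iSup_le fun ζ => ?_
    exact_mod_cast hM.partComputation_length_le hcrs hw ζ
  · rintro ⟨ha, hb⟩ n w hw rfl ζ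
    refine M.le_of_short_and_parts M.three_le_card ha (fun crs hcrs x hx h1 h2 ξ => ?_) w hw ζ
    have hle : ((ξ.length : ℕ∞) : WithBot ℕ∞) ≤ M.partTime x crs :=
      le_iSup (fun ξ : M.PartComputation x crs => ((ξ.length : ℕ∞) : WithBot ℕ∞)) ξ
    have h0 : (0 : WithBot ℕ∞) ≤ ((ξ.length : ℕ∞) : WithBot ℕ∞) := by
      exact_mod_cast Nat.zero_le _
    exact_mod_cast hle.trans (hb crs hcrs x hx h1 h2 (h0.trans hle))
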